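/- For $q>0$ and $t\in\mathbb R$ put $[t]_q=\frac{q^t-q^{-t}}{q-q^{-1}}$ if $q\neq1$ and $[t]_1=t$. For $S\in\frac12\mathbb Z_{\ge0}=\{0,\frac12,1,\dots\}$ let $\mathcal H_S=\mathbb C^{2S+1}$ with orthonormal basis $|k\rangle$, $k=S,S-1,\dots,-S$, be the spin-$S$ irreducible $*$-representation of $U_q(su_2)$ (of $U(su_2)$ if $q=1$): $$H|k\rangle=k|k\rangle,\quad K^{\pm1}|k\rangle=q^{\pm k}|k\rangle,\quad X^{\pm}|k\rangle=\sqrt{[S\mp k]_q[S\pm k+1]_q}\;|k\pm1\rangle .$$ On $\mathcal H_S\otimes\mathcal H_S$ let $\Delta(X^\pm)=X^\pm\otimes K+K^{-1}\otimes X^\pm$, $\Delta(K^{\pm1})=K^{\pm1}\otimes K^{\pm1}$, $\Delta(H)=H\otimes1+1\otimes H$, and let $\Delta(C_q)$ be the action of the Casimir element $C_q=X^-X^++\frac{(K-K^{-1})(qK-q^{-1}K^{-1})}{(q-q^{-1})^2}$ for $q\ne1$, $C_1=X^-X^++H(H+1)$. For integers $0\le J\le 2S$ and $-J\le m\le J$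 let $|J,m\rangle_q\in\mathcal H_S\otimes\mathcal H_S$ be the normalized joint eigenvector, unique up to a phase, of $\Delta(K)$ with eigenvalue $q^m$ (of $\Delta(H)$ with eigenvalue $m$ if $q=1$) and of $\Delta(C_q)$ with eigenvalue $[J]_q[J+1]_q$. Let $P$ be the orthogonal projection of $\mathcal H_S\otimes\mathcal H_S$ onto the line spanned by $|J,m\rangle_q$. The vector $|J,m\rangle_q$ is called a TL vector if for some $Q>0$ the operator $T=QP$ satisfies $$T^*=T,\qquad T^2=QT,\qquad T_{12}T_{23}T_{12}=T_{12},\qquad T_{23}T_{12}T_{23}=T_{23},$$ where $T_{12}=T\otimes1$ and $T_{23}=1\otimes T$ act on $\mathcal H_S^{\otimes3}$. Theorem. a) For $q=1$, the exhaustive list of TL vectors $|J,m\rangle_{q=1}$ is: $|0,0\rangle_{q=1}$ for all $S\in\frac12\mathbb Z_{\ge0}$; $|1,0\rangle_{q=1}$ for $S=\frac12$; $|2,0\rangle_{q=1}$ for $S=\frac32$. In all three cases the corresponding value of $Q$ is $Q=2S+1$. b) The exhaustive list of vectors $|J,m\rangle_q$ which are TL vectors for all $q>0$ is: $|0,0\rangle_q$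 for all $S\in\frac12\mathbb Z_{\ge0}$; $|1,0\rangle_q$ for $S=\frac12$. In both cases the corresponding value of $Q$ is $Q=[2S+1]_q$. -/

import Mathlib

open Matrix
open scoped Kronecker

noncomputable section

namespace TLVec

/-! ## Spin-`S` modules

The spin `S ∈ {0, 1/2, 1, ...}` is encoded by the natural number `twoS = 2S`.  The module `H_S` is
`ℂ^(2S+1)` with the orthonormal basis `e_a`, `a = 0, ..., 2S`, where `e_a = |S - a⟩`. -/

/-- The q-number `[t]_q`. -/
def qNum (q t : ℝ) : ℝ :=
  if q = 1 then t else (q ^ t - q ^ (-t)) / (q - q⁻¹)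

/-- The spin `S`. -/
def spin (twoS : ℕ) : ℝ := (twoS : ℝ) / 2

/-- The weight `S - a` of the basis vector `e_a`. -/
def weight (twoS : ℕ) (a : Fin (twoS + 1)) : ℝ := spin twoS - (a : ℕ)

/-- Operators on `H_S`. -/
abbrev Op (twoS : ℕ) := Matrix (Fin (twoS + 1)) (Fin (twoS + 1)) ℂ

/-- Operators on `H_S ⊗ H_S`; the basis vector `e_a ⊗ e_b` has index `(a, b)`. -/
abbrev Op2 (twoS : ℕ) :=
  Matrix (Fin (twoS + 1) × Fin (twoS + 1)) (Fin (twoS + 1) × Fin (twoS + 1)) ℂ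

/-- Operators on `H_S ⊗ H_S ⊗ H_S`. -/
abbrev Op3 (twoS : ℕ) :=
  Matrix ((Fin (twoS + 1) × Fin (twoS + 1)) × Fin (twoS + 1))
    ((Fin (twoS + 1) × Fin (twoS + 1)) × Fin (twoS + 1)) ℂ

/-- The Hilbert space `H_S ⊗ H_S`. -/
abbrev Space2 (twoS : ℕ) := EuclideanSpace ℂ (Fin (twoS + 1) × Fin (twoS + 1))

/-- `H |m⟩ = m |m⟩`. -/
def opH (twoS : ℕ) : Op twoS := diagonal fun a => ((weight twoS a : ℝ) : ℂ)

/-- `K |m⟩ = q^m |m⟩`. -/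
def opK (twoS : ℕ) (q : ℝ) : Op twoS := diagonal fun a => ((q ^ weight twoS a : ℝ) : ℂ)

/-- `K⁻¹ |m⟩ = q^(-m) |m⟩`. -/
def opKinv (twoS : ℕ) (q : ℝ) : Op twoS := diagonal fun a => ((q ^ (-weight twoS a) : ℝ) : ℂ)

/-- `X⁺ |m⟩ = ([S - m] [S + m + 1])^(1/2) |m + 1⟩`. -/
def opXp (twoS : ℕ) (q : ℝ) : Op twoS := of fun a b =>
  if (a : ℕ) + 1 = (b : ℕ) then
    ((Real.sqrt (qNum q (spin twoS - weight twoS b) *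
      qNum q (spin twoS + weight twoS b + 1)) : ℝ) : ℂ)
  else 0

/-- `X⁻ = (X⁺)*`. -/
def opXm (twoS : ℕ) (q : ℝ) : Op twoS := (opXp twoS q)ᴴ

/-! ## The tensor square

The comultiplication is `Δ(X^±) = X^± ⊗ K + K⁻¹ ⊗ X^±`, `Δ(K^±1) = K^±1 ⊗ K^±1`,
`Δ(H) = H ⊗ 1 + 1 ⊗ H`.  For `q = 1` one has `K = 1`, so that `Δ(X^±) = X^± ⊗ 1 + 1 ⊗ X^±`. -/

/-- The action of `Δ(H)` (used for `q = 1`). -/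
def deltaH (twoS : ℕ) : Op2 twoS := opH twoS ⊗ₖ 1 + 1 ⊗ₖ opH twoS

/-- The action of `Δ(K)`. -/
def deltaK (twoS : ℕ) (q : ℝ) : Op2 twoS := opK twoS q ⊗ₖ opK twoS q

/-- The action of `Δ(K⁻¹)`. -/
def deltaKinv (twoS : ℕ) (q : ℝ) : Op2 twoS := opKinv twoS q ⊗ₖ opKinv twoS q

/-- The action of `Δ(X⁺)`. -/
def deltaXp (twoS : ℕ) (q : ℝ) : Op2 twoS :=
  opXp twoS q ⊗ₖ opK twoS q + opKinv twoS q ⊗ₖ opXp twoS q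

/-- The action of `Δ(X⁻)`. -/
def deltaXm (twoS : ℕ) (q : ℝ) : Op2 twoS :=
  opXm twoS q ⊗ₖ opK twoS q + opKinv twoS q ⊗ₖ opXm twoS q

/-- The action of `Δ(C_q)`, where `C_1 = X⁻ X⁺ + H (H + 1)` for `q = 1` and
`C_q = X⁻ X⁺ + (K - K⁻¹) (q K - q⁻¹ K⁻¹) / (q - q⁻¹)²` for `q ≠ 1`. -/
def deltaC (twoS : ℕ) (q : ℝ) : Op2 twoS :=
  if q = 1 then
    deltaXm twoS q * deltaXp twoS q + deltaH twoS * (deltaH twoS + 1)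
  else
    deltaXm twoS q * deltaXp twoS q +
      (((q - q⁻¹) ^ 2 : ℝ) : ℂ)⁻¹ •
        ((deltaK twoS q - deltaKinv twoS q) *
          ((q : ℂ) • deltaK twoS q - (q : ℂ)⁻¹ • deltaKinv twoS q))

/-- `v` is the vector `|J, m⟩_q` of `H_S ⊗ H_S`, i.e. (uniquely up to a phase, for `0 ≤ J ≤ 2S` and
`-J ≤ m ≤ J`) the normalized joint eigenvector of `Δ(K)` and `Δ(C_q)`, or of `Δ(H)` and `Δ(C_1)` if
`q = 1`, with eigenvalues `q^m` (resp. `m`) and `[J] [J + 1]`. -/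
structure IsKet (twoS : ℕ) (q : ℝ) (J : ℕ) (m : ℤ) (v : Space2 twoS) : Prop where
  norm_eq : ‖v‖ = 1
  weight_eq : if q = 1 then deltaH twoS *ᵥ v.ofLp = (m : ℂ) • v.ofLp
    else deltaK twoS q *ᵥ v.ofLp = ((q ^ m : ℝ) : ℂ) • v.ofLp
  casimir_eq : deltaC twoS q *ᵥ v.ofLp = ((qNum q J * qNum q (J + 1) : ℝ) : ℂ) • v.ofLp

/-! ## The Temperley–Lieb equations -/

/-- `T₁₂ = T ⊗ 1`. -/
def leg12 {twoS : ℕ} (T : Op2 twoS) : Op3 twoS := T ⊗ₖ (1 : Op twoS)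

/-- `T₂₃ = 1 ⊗ T`. -/
def leg23 {twoS : ℕ} (T : Op2 twoS) : Op3 twoS :=
  ((1 : Op twoS) ⊗ₖ T).submatrix (Equiv.prodAssoc _ _ _) (Equiv.prodAssoc _ _ _)

/-- The equations (T1)-(T4). -/
structure IsTLSolution {twoS : ℕ} (Q : ℝ) (T : Op2 twoS) : Prop where
  t1 : Tᴴ = T
  t2 : T * T = (Q : ℂ) • T
  t3 : leg12 T * leg23 T * leg12 T = leg12 T
  t4 : leg23 T * leg12 T * leg23 T = leg23 T

/-- The matrix of the orthogonal projection onto the line spanned by `v`. -/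
def proj {twoS : ℕ} (v : Space2 twoS) : Op2 twoS :=
  (Matrix.toEuclideanCLM (n := Fin (twoS + 1) × Fin (twoS + 1)) (𝕜 := ℂ)).symm
    (Submodule.span ℂ {v}).starProjection

/-- `|J, m⟩_q` is a TL vector: for some `Q > 0`, `T = Q P` solves (T1)-(T4), where `P` is the
orthogonal projection onto the line spanned by `|J, m⟩_q`. -/
def IsTLVector (twoS : ℕ) (q : ℝ) (J : ℕ) (m : ℤ) : Prop :=
  ∃ v : Space2 twoS, IsKet twoS q J m v ∧
    ∃ Q : ℝ, 0 < Q ∧ IsTLSolution Q ((Q : ℂ) • proj v)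

end TLVec

end

/-! For a unit vector `v` with coefficient matrix `M`, the maps `e_d ↦ v ⊗ e_d` and `e_d ↦ e_d ⊗ v`
are isometries `A`, `B` with `T₁₂ = Q A Aᴴ`, `T₂₃ = Q B Bᴴ` and `Aᴴ B = Mᵀ Mᴴ`, so the
Temperley–Lieb equations say exactly that `Q Mᵀ Mᴴ` is unitary. A vector of weight `m ≠ 0` has a
zero column in its coefficient matrix, so `m = 0` and the coefficients sit on an antidiagonal. After
division by `q^(S - a)` they form a sequence `y` with `Q |y_a| |y_(2S - a)| = 1`, and the Casimir
equation becomes a symmetric three-term recurrence for `y` whose solution is unique up to scaling.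

At `q = 1` the recurrence is invariant under `a ↦ 2S - a`, so all `|y_a|` are equal. A relation
`r (y_(a + 1) + y_a) = c y_a` with real `r`, `c` and `|y_(a + 1)| = |y_a|` leaves only `c = 0` or
`c = 2 r`, and the first three recurrence relations then leave only the list. For `S = 3/2`, `J = 2`
and general `q`, the recurrence gives `|1 - (q² - q⁻²)²| = 1`, which fails at `q = 2`. -/

noncomputable section

namespace TLVec

section Isometries

variable {m n : Type*} [Fintype m] [Fintype n] [DecidableEq n]

theorem isometry_conj_inj {R : Type*} [Semiring R] [StarRing R] {A : Matrix m n R}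
    (hA : Aᴴ * A = 1) {X Y : Matrix n n R} : A * X * Aᴴ = A * Y * Aᴴ ↔ X = Y := by
  have cancel (Z : Matrix n n R) : Aᴴ * (A * Z * Aᴴ) * A = Z := by
    calc Aᴴ * (A * Z * Aᴴ) * A = (Aᴴ * A) * Z * (Aᴴ * A) := by simp only [Matrix.mul_assoc]
      _ = Z := by rw [hA, Matrix.one_mul, Matrix.mul_one]
  refine ⟨fun h => ?_, fun h => h ▸ rfl⟩
  rw [← cancel X, h, cancel]

theorem smul_mul_smul_mul_smul_eq_iff {K : Type*} [Field K] [StarRing K] {A B : Matrix m n K}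
    (hA : Aᴴ * A = 1) {c : K} (hc : c ≠ 0) (hc' : star c = c) :
    (c • (A * Aᴴ)) * (c • (B * Bᴴ)) * (c • (A * Aᴴ)) = c • (A * Aᴴ) ↔
      c • (Aᴴ * B) ∈ unitaryGroup n K := by
  have hprod : (c • (A * Aᴴ)) * (c • (B * Bᴴ)) * (c • (A * Aᴴ)) =
      c • (A * ((c • (Aᴴ * B)) * star (c • (Aᴴ * B))) * Aᴴ) := by
    simp only [star_eq_conjTranspose, conjTranspose_smul, conjTranspose_mul,
      conjTranspose_conjTranspose, hc', Matrix.mul_smul, Matrix.smul_mul, Matrix.mul_assoc]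
  rw [hprod, smul_right_inj hc, mem_unitaryGroup_iff, ← isometry_conj_inj hA, Matrix.mul_one]

end Isometries

section RankOne

variable {n : ℕ}

/-- The column matrix of the map `ℂ → H_S ⊗ H_S`, `1 ↦ v`. -/
abbrev colMatrix (v : Space2 n) : Matrix (Fin (n + 1) × Fin (n + 1)) Unit ℂ :=
  replicateCol Unit v.ofLp

/-- The matrix `M` of coefficients of `v = ∑ M a b • (e_a ⊗ e_b)`. -/
def coeffMatrix (v : Space2 n) : Op n := of fun a b => v.ofLp (a, b)

/-- The matrix of the map `e_d ↦ v ⊗ e_d`. -/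
def insertLeft (v : Space2 n) :
    Matrix ((Fin (n + 1) × Fin (n + 1)) × Fin (n + 1)) (Fin (n + 1)) ℂ :=
  (colMatrix v ⊗ₖ (1 : Op n)).submatrix (Equiv.refl _) (Equiv.punitProd _).symm

/-- The matrix of the map `e_d ↦ e_d ⊗ v`. -/
def insertRight (v : Space2 n) :
    Matrix ((Fin (n + 1) × Fin (n + 1)) × Fin (n + 1)) (Fin (n + 1)) ℂ :=
  ((1 : Op n) ⊗ₖ colMatrix v).submatrix (Equiv.prodAssoc _ _ _) (Equiv.prodPUnit _).symm

theorem colMatrix_isometry {v : Space2 n} (hv : ‖v‖ = 1) : (colMatrix v)ᴴ * colMatrix v = 1 := by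
  ext
  rw [one_apply_eq, ← inner_self_eq_one_of_norm_eq_one (𝕜 := ℂ) hv,
    EuclideanSpace.inner_eq_star_dotProduct, dotProduct_comm]
  rfl

theorem proj_eq {v : Space2 n} (hv : ‖v‖ = 1) : proj v = colMatrix v * (colMatrix v)ᴴ := by
  have hrank : toEuclideanCLM (𝕜 := ℂ) (proj v) = (ℂ ∙ v).starProjection :=
    (toEuclideanCLM (𝕜 := ℂ)).apply_symm_apply _
  ext i j
  have hij := congrArg (fun f => (f (EuclideanSpace.single j 1)).ofLp i) hrank
  simpa [Submodule.starProjection_unit_singleton ℂ hv, mul_apply, mul_comm,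
    EuclideanSpace.inner_single_right] using hij

theorem insertLeft_isometry {v : Space2 n} (hv : ‖v‖ = 1) :
    (insertLeft v)ᴴ * insertLeft v = 1 := by
  rw [insertLeft, conjTranspose_submatrix, submatrix_mul_equiv, conjTranspose_kronecker,
    ← mul_kronecker_mul, colMatrix_isometry hv, conjTranspose_one, Matrix.one_mul,
    one_kronecker_one, submatrix_one_equiv]

theorem insertRight_isometry {v : Space2 n} (hv : ‖v‖ = 1) :
    (insertRight v)ᴴ * insertRight v = 1 := by
  rw [insertRight, conjTranspose_submatrix, submatrix_mul_equiv, conjTranspose_kronecker,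
    ← mul_kronecker_mul, colMatrix_isometry hv, conjTranspose_one, Matrix.one_mul,
    one_kronecker_one, submatrix_one_equiv]

theorem leg12_smul_proj {v : Space2 n} (hv : ‖v‖ = 1) (c : ℂ) :
    leg12 (c • proj v) = c • (insertLeft v * (insertLeft v)ᴴ) := by
  rw [insertLeft, conjTranspose_submatrix, submatrix_mul_equiv, conjTranspose_kronecker,
    ← mul_kronecker_mul, conjTranspose_one, Matrix.one_mul, leg12, proj_eq hv, smul_kronecker]
  rfl

theorem leg23_smul_proj {v : Space2 n} (hv : ‖v‖ = 1) (c : ℂ) :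
    leg23 (c • proj v) = c • (insertRight v * (insertRight v)ᴴ) := by
  rw [insertRight, conjTranspose_submatrix, submatrix_mul_equiv, conjTranspose_kronecker,
    ← mul_kronecker_mul, conjTranspose_one, Matrix.one_mul, leg23, proj_eq hv, kronecker_smul,
    submatrix_smul]
  rfl

theorem insertLeft_conjTranspose_mul_insertRight (v : Space2 n) :
    (insertLeft v)ᴴ * insertRight v = (coeffMatrix v)ᵀ * (coeffMatrix v)ᴴ := by
  ext d e
  simp [insertLeft, insertRight, coeffMatrix, mul_apply, Fintype.sum_prod_type, one_apply,
    apply_ite, mul_comm]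

theorem isTLSolution_iff_mem_unitaryGroup {v : Space2 n} (hv : ‖v‖ = 1) {Q : ℝ} (hQ : Q ≠ 0) :
    IsTLSolution Q ((Q : ℂ) • proj v) ↔
      (Q : ℂ) • ((coeffMatrix v)ᵀ * (coeffMatrix v)ᴴ) ∈ unitaryGroup (Fin (n + 1)) ℂ := by
  have hQ' : (Q : ℂ) ≠ 0 := Complex.ofReal_ne_zero.mpr hQ
  have hQstar : star (Q : ℂ) = Q := Complex.conj_ofReal Q
  have hT3 := smul_mul_smul_mul_smul_eq_iff (B := insertRight v) (insertLeft_isometry hv) hQ' hQstar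
  have hT4 := smul_mul_smul_mul_smul_eq_iff (B := insertLeft v) (insertRight_isometry hv) hQ' hQstar
  have hstar : (Q : ℂ) • ((insertRight v)ᴴ * insertLeft v) =
      star ((Q : ℂ) • ((insertLeft v)ᴴ * insertRight v)) := by
    simp only [star_smul, hQstar, star_eq_conjTranspose, conjTranspose_mul,
      conjTranspose_conjTranspose]
  rw [hstar, Unitary.star_mem_iff] at hT4
  rw [← insertLeft_conjTranspose_mul_insertRight]
  simp only [← leg12_smul_proj hv, ← leg23_smul_proj hv] at hT3 hT4
  refine ⟨fun h => hT3.mp h.t3, fun h => ⟨?_, ?_, hT3.mpr h, hT4.mpr h⟩⟩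
  · rw [conjTranspose_smul, hQstar, proj_eq hv, conjTranspose_mul, conjTranspose_conjTranspose]
  · rw [Matrix.smul_mul, Matrix.mul_smul, proj_eq hv, Matrix.mul_assoc,
      ← Matrix.mul_assoc _ _ (colMatrix v)ᴴ, colMatrix_isometry hv, Matrix.one_mul]

end RankOne

section QNumbers

variable {q : ℝ}

theorem sub_inv_ne_zero (hq : 0 < q) (h1 : q ≠ 1) : q - q⁻¹ ≠ 0 := by
  rw [sub_ne_zero, Ne, self_eq_inv₀]
  rintro (h | h | h)
  · linarith
  · exact hq.ne' h
  · exact h1 h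

theorem two_mul_spin (n : ℕ) : 2 * spin n = n := mul_div_cancel₀ _ two_ne_zero

theorem qNum_one_left (t : ℝ) : qNum 1 t = t := if_pos rfl

theorem qNum_zero (q : ℝ) : qNum q 0 = 0 := by
  simp [qNum]

theorem qNum_pos (hq : 0 < q) {t : ℝ} (ht : 0 < t) : 0 < qNum q t := by
  unfold qNum
  split_ifs with h
  · exact ht
  have ht' : -t < t := by linarith
  rcases lt_or_gt_of_ne h with h | h
  · exact div_pos_of_neg_of_neg (sub_neg.mpr (Real.rpow_lt_rpow_of_exponent_gt hq h ht'))
      (sub_neg.mpr (h.trans ((one_lt_inv₀ hq).mpr h)))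
  · exact div_pos (sub_pos.mpr (Real.rpow_lt_rpow_of_exponent_lt h ht'))
      (sub_pos.mpr ((inv_lt_one_of_one_lt₀ h).trans h))

theorem qNum_nonneg (hq : 0 < q) {t : ℝ} (ht : 0 ≤ t) : 0 ≤ qNum q t := by
  rcases ht.eq_or_lt with rfl | ht
  · rw [qNum_zero]
  · exact (qNum_pos hq ht).le

theorem qNum_natCast_add_one (hq : 0 < q) (n : ℕ) :
    qNum q (n + 1) = ∑ a ∈ Finset.range (n + 1), q ^ ((n : ℝ) - 2 * a) := by
  unfold qNum
  split_ifs with h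
  · simp [h]
  · have hstep (a : ℕ) : q ^ ((n : ℝ) - 2 * a) * (q - q⁻¹) =
        q ^ ((n : ℝ) + 1 - 2 * a) - q ^ ((n : ℝ) + 1 - 2 * (a + 1 : ℕ)) := by
      rw [mul_sub, ← Real.rpow_add_one hq.ne', ← div_eq_mul_inv,
        ← Real.rpow_sub_one hq.ne']
      congr 2 <;> push_cast <;> ring
    rw [div_eq_iff (sub_inv_ne_zero hq h), Finset.sum_mul, Finset.sum_congr rfl fun a _ => hstep a,
      Finset.sum_range_sub' fun a : ℕ => q ^ ((n : ℝ) + 1 - 2 * a)]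
    congr 2 <;> push_cast <;> ring

theorem qNum_one (hq : 0 < q) : qNum q 1 = 1 := by
  simpa using qNum_natCast_add_one hq 0

theorem qNum_two (hq : 0 < q) : qNum q 2 = q + q⁻¹ := by
  have h := qNum_natCast_add_one hq 1
  norm_num [Finset.sum_range_succ, Real.rpow_neg_one] at h
  exact h

/-- The square `[b] [2S + 1 - b]` of the matrix coefficient of `X⁺` from `e_b` to `e_(b - 1)`. -/
def ladder (n : ℕ) (q : ℝ) (b : ℕ) : ℝ := qNum q b * qNum q (n + 1 - b)

theorem ladder_one (n a : ℕ) : ladder n 1 a = a * (n + 1 - a) := by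
  rw [ladder, qNum_one_left, qNum_one_left]

theorem ladder_zero (n : ℕ) (q : ℝ) : ladder n q 0 = 0 := by
  simp [ladder, qNum_zero]

theorem ladder_top (n : ℕ) (q : ℝ) : ladder n q (n + 1) = 0 := by
  simp [ladder, qNum_zero]

theorem ladder_symm {n : ℕ} (q : ℝ) {a b : ℕ} (h : a + b = n + 1) :
    ladder n q a = ladder n q b := by
  have h' : (a : ℝ) + b = n + 1 := mod_cast h
  rw [ladder, ladder, ← h', add_sub_cancel_left, add_sub_cancel_right, mul_comm]

theorem ladder_nonneg (hq : 0 < q) {n b : ℕ} (hb : b ≤ n + 1) : 0 ≤ ladder n q b := by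
  have hb' : (b : ℝ) ≤ n + 1 := mod_cast hb
  exact mul_nonneg (qNum_nonneg hq b.cast_nonneg) (qNum_nonneg hq (sub_nonneg.mpr hb'))

theorem ladder_pos (hq : 0 < q) {n b : ℕ} (h0 : 0 < b) (hb : b ≤ n) : 0 < ladder n q b := by
  have hb' : (b : ℝ) < n + 1 := mod_cast Nat.lt_succ_of_le hb
  exact mul_pos (qNum_pos hq (Nat.cast_pos.mpr h0)) (qNum_pos hq (sub_pos.mpr hb'))

end QNumbers

section Operators

variable {n : ℕ} {q : ℝ}

theorem opXp_apply (a b : Fin (n + 1)) :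
    opXp n q a b = if (a : ℕ) + 1 = b then (√(ladder n q b) : ℂ) else 0 := by
  simp only [opXp, of_apply, ladder, weight, spin]
  congr 5 <;> ring_nf

theorem opXp_mulVec (f : ℕ → ℂ) (a : Fin (n + 1)) :
    (opXp n q *ᵥ fun b => f b) a = (√(ladder n q (a + 1)) : ℂ) * f (a + 1) := by
  simp only [mulVec, dotProduct, opXp_apply, ite_mul, zero_mul]
  rw [Fin.sum_univ_eq_sum_range fun b => if (a : ℕ) + 1 = b then (√(ladder n q b) : ℂ) * f b else 0,
    Finset.sum_ite_eq]
  split_ifs with h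
  · rfl
  · have ha : (a : ℕ) = n := by rw [Finset.mem_range] at h; omega
    rw [ha, ladder_top, Real.sqrt_zero, Complex.ofReal_zero, zero_mul]

theorem opXm_mulVec (f : ℕ → ℂ) (a : Fin (n + 1)) :
    (opXm n q *ᵥ fun b => f b) a = (√(ladder n q a) : ℂ) * f (a - 1) := by
  simp only [opXm, mulVec, dotProduct, conjTranspose_apply, opXp_apply, apply_ite star, star_zero,
    Complex.star_def, Complex.conj_ofReal, ite_mul, zero_mul]
  rw [Fin.sum_univ_eq_sum_range fun b => if b + 1 = (a : ℕ) then (√(ladder n q a) : ℂ) * f b else 0]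
  have ha : (a : ℕ) < n + 1 := a.2
  rcases ha' : (a : ℕ) with _ | c
  · simp [ladder_zero]
  · simp only [add_left_inj, Finset.sum_ite_eq', Finset.mem_range, add_tsub_cancel_right]
    rw [if_pos (by omega)]

theorem kronecker_mulVec_apply {l m R : Type*} [Fintype l] [Fintype m] [CommSemiring R]
    (A : Matrix l l R) (B : Matrix m m R) (v : l × m → R) (a : l) (b : m) :
    ((A ⊗ₖ B) *ᵥ v) (a, b) = (A *ᵥ fun x => (B *ᵥ fun y => v (x, y)) b) a := by
  simp only [mulVec, dotProduct, Fintype.sum_prod_type, kroneckerMap_apply, Finset.mul_sum,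
    mul_assoc]

theorem deltaXp_mulVec (f : ℕ → ℕ → ℂ) (a b : Fin (n + 1)) :
    (deltaXp n q *ᵥ fun i => f i.1 i.2) (a, b) =
      (√(ladder n q (a + 1)) : ℂ) * ((q ^ weight n b : ℝ) * f (a + 1) b) +
        (q ^ (-weight n a) : ℝ) * ((√(ladder n q (b + 1)) : ℂ) * f a (b + 1)) := by
  rw [deltaXp, add_mulVec, Pi.add_apply, kronecker_mulVec_apply, kronecker_mulVec_apply]
  simp only [opK, opKinv, mulVec_diagonal, opXp_mulVec]
  rw [opXp_mulVec fun x => ((q ^ weight n b : ℝ) : ℂ) * f x b]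

theorem deltaXm_mulVec (f : ℕ → ℕ → ℂ) (a b : Fin (n + 1)) :
    (deltaXm n q *ᵥ fun i => f i.1 i.2) (a, b) =
      (√(ladder n q a) : ℂ) * ((q ^ weight n b : ℝ) * f (a - 1) b) +
        (q ^ (-weight n a) : ℝ) * ((√(ladder n q b) : ℂ) * f a (b - 1)) := by
  rw [deltaXm, add_mulVec, Pi.add_apply, kronecker_mulVec_apply, kronecker_mulVec_apply]
  simp only [opK, opKinv, mulVec_diagonal, opXm_mulVec]
  rw [opXm_mulVec fun x => ((q ^ weight n b : ℝ) : ℂ) * f x b]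

theorem weight_add_weight (a b : Fin (n + 1)) : weight n a + weight n b = n - a - b := by
  simp only [weight, spin]
  ring

theorem deltaH_eq_diagonal (n : ℕ) :
    deltaH n = diagonal fun i => ((weight n i.1 + weight n i.2 : ℝ) : ℂ) := by
  simp only [deltaH, opH]
  rw [← diagonal_one, diagonal_kronecker_diagonal, diagonal_kronecker_diagonal, diagonal_add]
  simp

theorem deltaK_eq_diagonal (hq : 0 < q) :
    deltaK n q = diagonal fun i => ((q ^ (weight n i.1 + weight n i.2) : ℝ) : ℂ) := by
  simp only [deltaK, opK, diagonal_kronecker_diagonal, Real.rpow_add hq, Complex.ofReal_mul]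

theorem deltaKinv_eq_diagonal (hq : 0 < q) :
    deltaKinv n q = diagonal fun i => ((q ^ (-(weight n i.1 + weight n i.2)) : ℝ) : ℂ) := by
  simp only [deltaKinv, opKinv, diagonal_kronecker_diagonal, neg_add, Real.rpow_add hq,
    Complex.ofReal_mul]

theorem diagonal_mulVec_eq_smul_iff {ι K : Type*} [Fintype ι] [DecidableEq ι] [Field K]
    {d v : ι → K} {c : K} : diagonal d *ᵥ v = c • v ↔ ∀ i, d i ≠ c → v i = 0 := by
  simp only [funext_iff, mulVec_diagonal, Pi.smul_apply, smul_eq_mul, mul_eq_mul_right_iff,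
    or_iff_not_imp_left, Ne]

theorem weight_condition_iff (hq : 0 < q) {m : ℤ} {v : Fin (n + 1) × Fin (n + 1) → ℂ} :
    (if q = 1 then deltaH n *ᵥ v = (m : ℂ) • v else deltaK n q *ᵥ v = ((q ^ m : ℝ) : ℂ) • v) ↔
      ∀ a b : Fin (n + 1), (a : ℤ) + b + m ≠ n → v (a, b) = 0 := by
  have hweight (a b : Fin (n + 1)) : weight n a + weight n b = m ↔ (a : ℤ) + b + m = n := by
    rw [weight_add_weight, ← @Int.cast_inj ℝ]
    push_cast
    constructor <;> intro h <;> linarith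
  split_ifs with h1
  · have hH (a b : Fin (n + 1)) :
        ((weight n a + weight n b : ℝ) : ℂ) = m ↔ (a : ℤ) + b + m = n := by
      rw [← hweight]; norm_cast
    simp only [deltaH_eq_diagonal, diagonal_mulVec_eq_smul_iff, Prod.forall, Ne, hH]
  · simp only [deltaK_eq_diagonal hq, diagonal_mulVec_eq_smul_iff, Prod.forall, Ne,
      Complex.ofReal_inj, ← Real.rpow_intCast, Real.rpow_right_inj hq h1, hweight]

end Operators

section ZeroWeight

variable {n : ℕ} {q : ℝ} {y z : ℕ → ℂ}

/-- The weight zero vector with coefficient `q^(S - a) y_a` at `e_a ⊗ e_(2S - a)`. The power of `q`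
makes the Casimir recurrence for `y` symmetric. -/
def zeroWeightVec (n : ℕ) (q : ℝ) (y : ℕ → ℂ) : Space2 n :=
  WithLp.toLp 2 fun i =>
    if (i.1 : ℕ) + i.2 = n then ((q ^ (spin n - (i.1 : ℕ)) : ℝ) : ℂ) * y i.1 else 0

theorem zeroWeightVec_apply (a b : Fin (n + 1)) :
    (zeroWeightVec n q y).ofLp (a, b) =
      if (a : ℕ) + b = n then ((q ^ (spin n - (a : ℕ)) : ℝ) : ℂ) * y a else 0 := rfl

theorem zeroWeightVec_apply_eq_zero {a b : Fin (n + 1)} (hab : (a : ℕ) + b ≠ n) :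
    (zeroWeightVec n q y).ofLp (a, b) = 0 := by
  rw [zeroWeightVec_apply, if_neg hab]

theorem zeroWeightVec_apply_rev (a : Fin (n + 1)) :
    (zeroWeightVec n q y).ofLp (a, a.rev) = ((q ^ (spin n - (a : ℕ)) : ℝ) : ℂ) * y a := by
  rw [zeroWeightVec_apply, if_pos (by rw [Fin.val_rev]; omega)]

theorem zeroWeightVec_inj (hq : 0 < q) :
    zeroWeightVec n q y = zeroWeightVec n q z ↔ ∀ a ≤ n, y a = z a := by
  refine ⟨fun h a ha => ?_, fun h => PiLp.ext fun ⟨a, b⟩ => ?_⟩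
  · have hrev := congrArg (fun v => v.ofLp (⟨a, by omega⟩, Fin.rev ⟨a, by omega⟩)) h
    simp only [zeroWeightVec_apply_rev] at hrev
    exact mul_left_cancel₀ (Complex.ofReal_ne_zero.mpr (Real.rpow_pos_of_pos hq _).ne') hrev
  · rw [zeroWeightVec_apply, zeroWeightVec_apply, h a (by omega)]

theorem zeroWeightVec_const_mul (c : ℂ) :
    zeroWeightVec n q (fun a => c * y a) = c • zeroWeightVec n q y := by
  refine PiLp.ext fun ⟨a, b⟩ => ?_
  rw [PiLp.smul_apply, zeroWeightVec_apply, zeroWeightVec_apply, smul_eq_mul, mul_ite, mul_zero,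
    mul_left_comm]

theorem exists_eq_zeroWeightVec_iff (hq : 0 < q) {v : Space2 n} :
    (∃ y, v = zeroWeightVec n q y) ↔ ∀ a b : Fin (n + 1), (a : ℕ) + b ≠ n → v.ofLp (a, b) = 0 := by
  constructor
  · rintro ⟨y, rfl⟩ a b hab
    exact zeroWeightVec_apply_eq_zero hab
  intro h
  refine ⟨fun a => ((q ^ (spin n - a) : ℝ) : ℂ)⁻¹ * v.ofLp (Fin.ofNat _ a, (Fin.ofNat _ a).rev),
    PiLp.ext fun ⟨a, b⟩ => ?_⟩
  by_cases hab : (a : ℕ) + b = n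
  · obtain rfl : b = a.rev := Fin.ext (by rw [Fin.val_rev]; omega)
    rw [zeroWeightVec_apply_rev, Fin.ofNat_val_eq_self, mul_inv_cancel_left₀
      (Complex.ofReal_ne_zero.mpr (Real.rpow_pos_of_pos hq _).ne')]
  · rw [h a b hab, zeroWeightVec_apply_eq_zero hab]

theorem norm_sq_zeroWeightVec (hq : 0 < q) :
    ‖zeroWeightVec n q y‖ ^ 2 =
      ∑ a ∈ Finset.range (n + 1), q ^ ((n : ℝ) - 2 * a) * ‖y a‖ ^ 2 := by
  rw [EuclideanSpace.norm_sq_eq, Fintype.sum_prod_type,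
    ← Fin.sum_univ_eq_sum_range fun a => q ^ ((n : ℝ) - 2 * a) * ‖y a‖ ^ 2]
  refine Finset.sum_congr rfl fun a _ => ?_
  have hne (b : Fin (n + 1)) (hb : b ≠ a.rev) : (a : ℕ) + b ≠ n := fun h =>
    hb (Fin.ext (by rw [Fin.val_rev]; omega))
  rw [Finset.sum_eq_single a.rev (fun b _ hb => by
    rw [zeroWeightVec_apply_eq_zero (hne b hb), norm_zero, zero_pow two_ne_zero]) (by simp),
    zeroWeightVec_apply_rev, norm_mul, mul_pow, Complex.norm_real,
    Real.norm_of_nonneg (Real.rpow_nonneg hq.le _), ← Real.rpow_mul_natCast hq.le, spin]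
  congr 2
  push_cast
  ring

/-- The term of `Δ(X⁻) Δ(X⁺)` that couples `e_(a - 1)` and `e_a` in the first tensor factor, in the
coordinates of `zeroWeightVec`. At `a = 0` the truncated index `a - 1` is harmless, since
`ladder n q 0 = 0`. -/
def edgeTerm (n : ℕ) (q : ℝ) (y : ℕ → ℂ) (a : ℕ) : ℂ := ladder n q a * (y a + y (a - 1))

theorem deltaXp_mulVec_zeroWeightVec (hq : 0 < q) (y : ℕ → ℂ) :
    deltaXp n q *ᵥ (zeroWeightVec n q y).ofLp = fun i =>
      if (i.1 : ℕ) + i.2 + 1 = n then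
        (√(ladder n q (i.1 + 1)) : ℂ) * (y (i.1 + 1) + y i.1) else 0 := by
  ext ⟨a, b⟩
  refine (deltaXp_mulVec (fun a b =>
    if a + b = n then ((q ^ (spin n - a) : ℝ) : ℂ) * y a else 0) a b).trans ?_
  by_cases h : (a : ℕ) + b + 1 = n
  · have h' : (n : ℝ) = a + b + 1 := mod_cast h.symm
    have hb : spin n - b = -(spin n - (a + 1 : ℕ)) := by
      rw [spin, h']
      push_cast
      ring
    have hcancel (t : ℝ) : ((q ^ (-t) : ℝ) : ℂ) * ((q ^ t : ℝ) : ℂ) = 1 := by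
      rw [← Complex.ofReal_mul, ← Real.rpow_add hq, neg_add_cancel, Real.rpow_zero,
        Complex.ofReal_one]
    simp only [if_pos (show (a : ℕ) + 1 + b = n by omega), ← add_assoc, if_pos h,
      ladder_symm q (show (b : ℕ) + 1 + (a + 1) = n + 1 by omega), weight, hb]
    linear_combination (√(ladder n q (a + 1)) : ℂ) * y (a + 1) * hcancel (spin n - (a + 1 : ℕ)) +
      (√(ladder n q (a + 1)) : ℂ) * y a * hcancel (spin n - a)
  · simp only [if_neg (show (a : ℕ) + 1 + b ≠ n by omega), ← add_assoc, if_neg h,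
      mul_zero, add_zero]

theorem edgeTerm_zero : edgeTerm n q y 0 = 0 := by
  rw [edgeTerm, ladder_zero, Complex.ofReal_zero, zero_mul]

theorem edgeTerm_top : edgeTerm n q y (n + 1) = 0 := by
  rw [edgeTerm, ladder_top, Complex.ofReal_zero, zero_mul]

theorem edgeTerm_eq_sqrt_mul_sqrt (hq : 0 < q) (y : ℕ → ℂ) {a : ℕ} (ha : a ≤ n + 1) :
    edgeTerm n q y a = (√(ladder n q a) : ℂ) * ((√(ladder n q a) : ℂ) * (y a + y (a - 1))) := by
  rw [edgeTerm, ← mul_assoc, ← Complex.ofReal_mul, Real.mul_self_sqrt (ladder_nonneg hq ha)]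

theorem deltaXm_mulVec_deltaXp_mulVec_zeroWeightVec (hq : 0 < q) (y : ℕ → ℂ) :
    deltaXm n q *ᵥ (deltaXp n q *ᵥ (zeroWeightVec n q y).ofLp) =
      (zeroWeightVec n q fun a =>
        (q ^ (2 * a - n : ℝ) : ℝ) * (edgeTerm n q y (a + 1) + edgeTerm n q y a)).ofLp := by
  rw [deltaXp_mulVec_zeroWeightVec hq]
  ext ⟨a, b⟩
  refine (deltaXm_mulVec (fun a b => if a + b + 1 = n then
    (√(ladder n q (a + 1)) : ℂ) * (y (a + 1) + y a) else 0) a b).trans ?_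
  have hleft : (√(ladder n q a) : ℂ) * (if (a : ℕ) - 1 + b + 1 = n then
      (√(ladder n q (a - 1 + 1)) : ℂ) * (y (a - 1 + 1) + y (a - 1)) else 0) =
      if (a : ℕ) + b = n then edgeTerm n q y a else 0 := by
    rcases ha : (a : ℕ) with _ | c
    · simp [ladder_zero, edgeTerm_zero]
    · rw [edgeTerm_eq_sqrt_mul_sqrt hq y (by omega)]
      simp only [Nat.add_sub_cancel, add_right_comm, mul_ite, mul_zero]
  have hright : (√(ladder n q b) : ℂ) * (if (a : ℕ) + (b - 1) + 1 = n then
      (√(ladder n q (a + 1)) : ℂ) * (y (a + 1) + y a) else 0) =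
      if (a : ℕ) + b = n then edgeTerm n q y (a + 1) else 0 := by
    split_ifs with h1 h2 h2
    · rw [edgeTerm_eq_sqrt_mul_sqrt hq y (by omega), Nat.add_sub_cancel,
        ladder_symm q (show (b : ℕ) + (a + 1) = n + 1 by omega)]
    · rw [show (b : ℕ) = 0 by omega, ladder_zero, Real.sqrt_zero, Complex.ofReal_zero, zero_mul]
    · rw [show (a : ℕ) = n by omega, edgeTerm_top, mul_zero]
    · rw [mul_zero]
  rw [mul_left_comm, hleft, hright, zeroWeightVec_apply]
  split_ifs with hab
  · have hexp (t : ℝ) (ht : t = spin n - (a : ℕ) + (2 * (a : ℕ) - n)) :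
        ((q ^ t : ℝ) : ℂ) =
          (q ^ (spin n - (a : ℕ)) : ℝ) * (q ^ (2 * (a : ℕ) - n : ℝ) : ℝ) := by
      rw [ht, Real.rpow_add hq, Complex.ofReal_mul]
    have hab' : (n : ℝ) = a + b := mod_cast hab.symm
    rw [hexp (weight n b) (by simp only [weight, spin, hab']; ring),
      hexp (-weight n a) (by simp only [weight, spin]; ring)]
    ring
  · rw [mul_zero, mul_zero, add_zero]

theorem weight_add_weight_eq_zero {a b : Fin (n + 1)} (hab : (a : ℕ) + b = n) :
    weight n a + weight n b = 0 := by
  have hab' : (a : ℝ) + b = n := mod_cast hab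
  rw [weight_add_weight]
  linarith

theorem diagonal_mulVec_zeroWeightVec {d : Fin (n + 1) × Fin (n + 1) → ℂ} {c : ℂ}
    (hd : ∀ i, weight n i.1 + weight n i.2 = 0 → d i = c) :
    diagonal d *ᵥ (zeroWeightVec n q y).ofLp = c • (zeroWeightVec n q y).ofLp := by
  refine diagonal_mulVec_eq_smul_iff.mpr fun i hi => zeroWeightVec_apply_eq_zero fun hab => ?_
  exact hi (hd i (weight_add_weight_eq_zero hab))

theorem deltaC_mulVec_zeroWeightVec (hq : 0 < q) :
    deltaC n q *ᵥ (zeroWeightVec n q y).ofLp =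
      deltaXm n q *ᵥ (deltaXp n q *ᵥ (zeroWeightVec n q y).ofLp) := by
  unfold deltaC
  split_ifs with h
  · have hH : deltaH n *ᵥ (zeroWeightVec n q y).ofLp = 0 := by
      rw [deltaH_eq_diagonal, diagonal_mulVec_zeroWeightVec (c := 0) fun i hi => by simp [hi],
        zero_smul]
    rw [(Commute.refl (deltaH n)).add_right (Commute.one_right _), add_mulVec, ← mulVec_mulVec,
      ← mulVec_mulVec, hH, mulVec_zero, add_zero]
  · have hK : deltaK n q *ᵥ (zeroWeightVec n q y).ofLp = (zeroWeightVec n q y).ofLp := by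
      rw [deltaK_eq_diagonal hq, diagonal_mulVec_zeroWeightVec (c := 1) fun i hi => by simp [hi],
        one_smul]
    have hKinv : deltaKinv n q *ᵥ (zeroWeightVec n q y).ofLp = (zeroWeightVec n q y).ofLp := by
      rw [deltaKinv_eq_diagonal hq, diagonal_mulVec_zeroWeightVec (c := 1) fun i hi => by simp [hi],
        one_smul]
    rw [add_mulVec, ← mulVec_mulVec, smul_mulVec, ← mulVec_mulVec, sub_mulVec, sub_mulVec]
    simp [smul_mulVec, mulVec_sub, mulVec_smul, hK, hKinv]

/-- `y` solves the three-term recurrence expressing that `zeroWeightVec n q y` is an eigenvector of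
`Δ(C_q)` with eigenvalue `lam`. -/
def IsCasimirSeq (n : ℕ) (q lam : ℝ) (y : ℕ → ℂ) : Prop :=
  ∀ a ≤ n, edgeTerm n q y (a + 1) + edgeTerm n q y a = (lam * q ^ ((n : ℝ) - 2 * a) : ℝ) * y a

theorem deltaC_mulVec_zeroWeightVec_eq_smul_iff (hq : 0 < q) {lam : ℝ} :
    deltaC n q *ᵥ (zeroWeightVec n q y).ofLp = (lam : ℂ) • (zeroWeightVec n q y).ofLp ↔
      IsCasimirSeq n q lam y := by
  rw [deltaC_mulVec_zeroWeightVec hq, deltaXm_mulVec_deltaXp_mulVec_zeroWeightVec hq,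
    ← WithLp.ofLp_smul, (WithLp.ofLp_injective 2).eq_iff, ← zeroWeightVec_const_mul,
    zeroWeightVec_inj hq]
  refine forall₂_congr fun a _ => ?_
  have hinv : ((q ^ (2 * a - n : ℝ) : ℝ) : ℂ) = ((q ^ (n - 2 * a : ℝ) : ℝ) : ℂ)⁻¹ := by
    rw [← Complex.ofReal_inv, ← Real.rpow_neg hq.le, neg_sub]
  have hne : ((q ^ (n - 2 * a : ℝ) : ℝ) : ℂ) ≠ 0 :=
    Complex.ofReal_ne_zero.mpr (Real.rpow_pos_of_pos hq _).ne'
  rw [hinv, inv_mul_eq_iff_eq_mul₀ hne, Complex.ofReal_mul]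
  ring_nf

theorem isKet_zero_iff (hq : 0 < q) {J : ℕ} {v : Space2 n} :
    IsKet n q J 0 v ↔ ‖v‖ = 1 ∧
      ∃ y, v = zeroWeightVec n q y ∧ IsCasimirSeq n q (qNum q J * qNum q (J + 1)) y := by
  have hweight : (∃ y, v = zeroWeightVec n q y) ↔ if q = 1 then
      deltaH n *ᵥ v.ofLp = ((0 : ℤ) : ℂ) • v.ofLp
      else deltaK n q *ᵥ v.ofLp = ((q ^ (0 : ℤ) : ℝ) : ℂ) • v.ofLp := by
    rw [weight_condition_iff hq, exists_eq_zeroWeightVec_iff hq]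
    exact forall₂_congr fun a b => imp_congr_left (not_congr (by omega))
  constructor
  · rintro ⟨hnorm, hw, hC⟩
    obtain ⟨y, rfl⟩ := hweight.mpr hw
    exact ⟨hnorm, y, rfl, (deltaC_mulVec_zeroWeightVec_eq_smul_iff hq).mp hC⟩
  · rintro ⟨hnorm, y, rfl, hy⟩
    exact ⟨hnorm, hweight.mp ⟨y, rfl⟩, (deltaC_mulVec_zeroWeightVec_eq_smul_iff hq).mpr hy⟩

end ZeroWeight

section TLSequences

variable {n : ℕ} {q : ℝ} {y z : ℕ → ℂ}

theorem coeffMatrix_zeroWeightVec_transpose_mul_conjTranspose (hq : 0 < q) :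
    (coeffMatrix (zeroWeightVec n q y))ᵀ * (coeffMatrix (zeroWeightVec n q y))ᴴ =
      diagonal fun a : Fin (n + 1) => star (y a) * y (n - a) := by
  have hzero {a b : Fin (n + 1)} (hab : b ≠ a.rev) : (zeroWeightVec n q y).ofLp (a, b) = 0 :=
    zeroWeightVec_apply_eq_zero fun h => hab (Fin.ext (by rw [Fin.val_rev]; omega))
  ext d e
  rw [mul_apply, Finset.sum_eq_single e.rev (fun b _ hb => by simp [coeffMatrix, hzero hb])
    (by simp)]
  simp only [coeffMatrix, transpose_apply, conjTranspose_apply, of_apply]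
  by_cases hde : d = e
  · subst hde
    have hcancel : ((q ^ (spin n - (d.rev : ℕ)) : ℝ) : ℂ) * ((q ^ (spin n - (d : ℕ)) : ℝ) : ℂ) =
        1 := by
      have hd : (d : ℝ) + (d.rev : ℕ) = n := by rw [Fin.val_rev]; norm_cast; omega
      rw [← Complex.ofReal_mul, ← Real.rpow_add hq,
        show spin n - (d.rev : ℕ) + (spin n - d) = 0 by rw [spin]; linarith, Real.rpow_zero,
        Complex.ofReal_one]
    have hrev := zeroWeightVec_apply_rev (q := q) (y := y) d.rev
    rw [Fin.rev_rev] at hrev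
    rw [hrev, zeroWeightVec_apply_rev, diagonal_apply_eq, star_mul', Complex.star_def,
      Complex.conj_ofReal, show n - (d : ℕ) = d.rev by rw [Fin.val_rev]; omega]
    linear_combination (starRingEnd ℂ) (y d) * y d.rev * hcancel
  · rw [diagonal_apply_ne _ hde, hzero (by rwa [Fin.rev_rev]), zero_mul]

theorem diagonal_mem_unitaryGroup_iff {ι : Type*} [Fintype ι] [DecidableEq ι] {d : ι → ℂ} :
    diagonal d ∈ unitaryGroup ι ℂ ↔ ∀ i, ‖d i‖ = 1 := by
  rw [mem_unitaryGroup_iff, star_eq_conjTranspose, diagonal_conjTranspose, diagonal_mul_diagonal,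
    ← diagonal_one, diagonal_eq_diagonal_iff]
  refine forall_congr' fun i => ?_
  rw [Pi.star_apply, Complex.star_def, Complex.mul_conj', ← pow_eq_one_iff_of_nonneg
    (norm_nonneg (d i)) two_ne_zero]
  norm_cast

theorem isTLSolution_zeroWeightVec_iff (hq : 0 < q) (hy : ‖zeroWeightVec n q y‖ = 1) {Q : ℝ}
    (hQ : 0 < Q) :
    IsTLSolution Q ((Q : ℂ) • proj (zeroWeightVec n q y)) ↔
      ∀ a ≤ n, Q * (‖y a‖ * ‖y (n - a)‖) = 1 := by
  rw [isTLSolution_iff_mem_unitaryGroup hy hQ.ne',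
    coeffMatrix_zeroWeightVec_transpose_mul_conjTranspose hq, ← diagonal_smul,
    diagonal_mem_unitaryGroup_iff, Fin.forall_iff]
  simp only [Pi.smul_apply, norm_smul, Complex.norm_real, Real.norm_of_nonneg hQ.le, norm_mul,
    norm_star, Nat.lt_succ_iff]

theorem IsCasimirSeq.proportional (hq : 0 < q) {lam : ℝ} (hy : IsCasimirSeq n q lam y)
    (hz : IsCasimirSeq n q lam z) {a : ℕ} (ha : a ≤ n) : y 0 * z a = z 0 * y a := by
  induction a using Nat.strong_induction_on with
  | _ a ih =>
    rcases a with _ | a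
    · exact mul_comm _ _
    have hcur := ih a (by omega) (by omega)
    have hprev := ih (a - 1) (by omega) (by omega)
    have hne : (ladder n q (a + 1) : ℂ) ≠ 0 :=
      Complex.ofReal_ne_zero.mpr (ladder_pos hq a.succ_pos ha).ne'
    have hya := hy a (by omega)
    have hza := hz a (by omega)
    simp only [edgeTerm, Nat.add_sub_cancel] at hya hza
    refine mul_left_cancel₀ hne ?_
    linear_combination y 0 * hza - z 0 * hya +
      ((lam * q ^ ((n : ℝ) - 2 * a) : ℝ) - ladder n q (a + 1) - ladder n q a : ℂ) * hcur -
      ladder n q a * hprev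

theorem IsCasimirSeq.const_mul {lam : ℝ} (hy : IsCasimirSeq n q lam y) (c : ℂ) :
    IsCasimirSeq n q lam fun a => c * y a := by
  intro a ha
  have hya := hy a ha
  simp only [edgeTerm] at hya ⊢
  linear_combination c * hya

/-- `z` describes a multiple of `|J, 0⟩_q` satisfying the Temperley–Lieb equations, scaled so that
the products `‖z_a‖ ‖z_(2S - a)‖`, which these equations force to be equal, are `1`. -/
structure IsTLSeq (n : ℕ) (q : ℝ) (J : ℕ) (z : ℕ → ℂ) : Prop where
  casimir : IsCasimirSeq n q (qNum q J * qNum q (J + 1)) z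
  norm_mul_norm : ∀ a ≤ n, ‖z a‖ * ‖z (n - a)‖ = 1

variable {J : ℕ} {m : ℤ}

theorem IsTLSeq.ne_zero (hz : IsTLSeq n q J z) {a : ℕ} (ha : a ≤ n) : z a ≠ 0 :=
  norm_ne_zero_iff.mp (left_ne_zero_of_mul_eq_one (hz.norm_mul_norm a ha))

theorem IsTLSeq.norm_zeroWeightVec_pos (hq : 0 < q) (hz : IsTLSeq n q J z) :
    0 < ‖zeroWeightVec n q z‖ := by
  refine lt_of_pow_lt_pow_left₀ 2 (norm_nonneg _) ?_
  rw [zero_pow two_ne_zero, norm_sq_zeroWeightVec hq]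
  refine Finset.sum_pos (fun a ha => mul_pos (Real.rpow_pos_of_pos hq _) ?_) (by simp)
  exact pow_pos (norm_pos_iff.mpr (hz.ne_zero (Finset.mem_range_succ_iff.mp ha))) 2

theorem IsTLSeq.isTLSolution_iff (hq : 0 < q) (hz : IsTLSeq n q J z) {v : Space2 n}
    (hv : IsKet n q J 0 v) {Q : ℝ} (hQ : 0 < Q) :
    IsTLSolution Q ((Q : ℂ) • proj v) ↔ Q = ‖zeroWeightVec n q z‖ ^ 2 := by
  obtain ⟨hnorm, y, rfl, hy⟩ := (isKet_zero_iff hq).mp hv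
  set c := y 0 / z 0
  have hyz {a : ℕ} (ha : a ≤ n) : y a = c * z a := by
    rw [div_mul_eq_mul_div, eq_div_iff (hz.ne_zero n.zero_le), hy.proportional hq hz.casimir ha,
      mul_comm]
  have hc : ‖c‖ ^ 2 * ‖zeroWeightVec n q z‖ ^ 2 = 1 := by
    rw [← mul_pow, ← norm_smul, ← zeroWeightVec_const_mul,
      ← (zeroWeightVec_inj hq).mpr fun a => hyz, hnorm, one_pow]
  have hprod {a : ℕ} (ha : a ≤ n) : ‖y a‖ * ‖y (n - a)‖ = ‖c‖ ^ 2 := by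
    rw [hyz ha, hyz (Nat.sub_le n a), norm_mul, norm_mul, mul_mul_mul_comm,
      hz.norm_mul_norm a ha, mul_one, sq]
  have hQc : Q * ‖c‖ ^ 2 = 1 ↔ Q = ‖zeroWeightVec n q z‖ ^ 2 := by
    rw [← hc, mul_comm Q, mul_right_inj' (left_ne_zero_of_mul_eq_one hc)]
  rw [isTLSolution_zeroWeightVec_iff hq hnorm hQ, ← hQc]
  exact ⟨fun h => hprod n.zero_le ▸ h 0 n.zero_le, fun h a ha => by rw [hprod ha, h]⟩

theorem IsTLSeq.exists_isKet (hq : 0 < q) (hz : IsTLSeq n q J z) : ∃ v, IsKet n q J 0 v := by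
  set v := zeroWeightVec n q z
  have hv : v ≠ 0 := norm_pos_iff.mp (hz.norm_zeroWeightVec_pos hq)
  exact ⟨(‖v‖⁻¹ : ℂ) • v, (isKet_zero_iff hq).mpr ⟨norm_smul_inv_norm hv, _,
    (zeroWeightVec_const_mul _).symm, hz.casimir.const_mul _⟩⟩

theorem IsTLVector.weight_eq_zero (hq : 0 < q) (h : IsTLVector n q J m) : m = 0 := by
  obtain ⟨v, hv, Q, hQ, hT⟩ := h
  rw [isTLSolution_iff_mem_unitaryGroup hv.norm_eq hQ.ne', mem_unitaryGroup_iff] at hT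
  have hsupport := (weight_condition_iff hq).mp hv.weight_eq
  by_contra hm
  obtain ⟨d, hd⟩ : ∃ d : Fin (n + 1), ∀ b, v.ofLp (b, d) = 0 := by
    rcases lt_or_gt_of_ne hm with hm | hm
    · exact ⟨0, fun b => hsupport _ _ (by rw [Fin.val_zero]; omega)⟩
    · exact ⟨Fin.last n, fun b => hsupport _ _ (by rw [Fin.val_last]; omega)⟩
  have hdd := congrFun₂ hT d d
  simp [mul_apply, coeffMatrix, hd] at hdd

theorem isTLVector_iff (hq : 0 < q) : IsTLVector n q J m ↔ m = 0 ∧ ∃ z, IsTLSeq n q J z := by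
  refine ⟨fun h => ?_, ?_⟩
  · obtain rfl := h.weight_eq_zero hq
    obtain ⟨v, hv, Q, hQ, hT⟩ := h
    obtain ⟨hnorm, y, rfl, hy⟩ := (isKet_zero_iff hq).mp hv
    refine ⟨rfl, fun a => (√Q : ℂ) * y a, hy.const_mul _, fun a ha => ?_⟩
    rw [norm_mul, norm_mul, mul_mul_mul_comm, Complex.norm_real,
      Real.norm_of_nonneg (Real.sqrt_nonneg Q), Real.mul_self_sqrt hQ.le,
      (isTLSolution_zeroWeightVec_iff hq hnorm hQ).mp hT a ha]
  · rintro ⟨rfl, z, hz⟩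
    obtain ⟨v, hv⟩ := hz.exists_isKet hq
    have hpos := pow_pos (hz.norm_zeroWeightVec_pos hq) 2
    exact ⟨v, hv, _, hpos, (hz.isTLSolution_iff hq hv hpos).mpr rfl⟩

end TLSequences

section Examples

variable {n : ℕ} {q : ℝ} {J : ℕ} {z : ℕ → ℂ}

theorem norm_sq_zeroWeightVec_of_norm_eq_one (hq : 0 < q) (hz : ∀ a ≤ n, ‖z a‖ = 1) :
    ‖zeroWeightVec n q z‖ ^ 2 = qNum q (n + 1) := by
  rw [norm_sq_zeroWeightVec hq, qNum_natCast_add_one hq]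
  refine Finset.sum_congr rfl fun a ha => ?_
  rw [hz a (Finset.mem_range_succ_iff.mp ha), one_pow, mul_one]

theorem isTLSeq_neg_one_pow (n : ℕ) (q : ℝ) : IsTLSeq n q 0 fun a => (-1) ^ a where
  casimir a _ := by
    have hedge (b : ℕ) : edgeTerm n q (fun a => (-1) ^ a) b = 0 := by
      rcases b with _ | b
      · exact edgeTerm_zero
      · simp [edgeTerm, pow_succ]
    simp [hedge, qNum_zero]
  norm_mul_norm a _ := by simp

theorem isTLSeq_one_one (hq : 0 < q) :
    IsTLSeq 1 q 1 fun a => if a = 0 then (q : ℂ)⁻¹ else q where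
  casimir a ha := by
    have hq' : (q : ℂ) ≠ 0 := Complex.ofReal_ne_zero.mpr hq.ne'
    interval_cases a <;>
    norm_num [edgeTerm, ladder, qNum_zero, qNum_one hq, qNum_two hq, Real.rpow_neg_one] <;>
    field_simp
  norm_mul_norm a ha := by
    interval_cases a <;> simp [hq.ne']

theorem isTLSeq_three_two : IsTLSeq 3 1 2 fun a => if a ≤ 1 then 1 else -1 where
  casimir a ha := by
    interval_cases a <;> norm_num [edgeTerm, ladder_one, qNum_one_left]
  norm_mul_norm a ha := by
    interval_cases a <;> simp

theorem exists_isTLSeq (hq : 0 < q)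
    (h : J = 0 ∨ (n = 1 ∧ J = 1) ∨ (q = 1 ∧ n = 3 ∧ J = 2)) :
    ∃ z, IsTLSeq n q J z ∧ ‖zeroWeightVec n q z‖ ^ 2 = qNum q (n + 1) := by
  rcases h with rfl | ⟨rfl, rfl⟩ | ⟨rfl, rfl, rfl⟩
  · exact ⟨_, isTLSeq_neg_one_pow n q,
      norm_sq_zeroWeightVec_of_norm_eq_one hq fun a _ => by simp⟩
  · refine ⟨_, isTLSeq_one_one hq, ?_⟩
    rw [norm_sq_zeroWeightVec hq]
    norm_num [Finset.sum_range_succ, qNum_two hq, Real.rpow_neg_one, abs_of_pos hq]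
    field_simp
    ring
  · exact ⟨_, isTLSeq_three_two,
      norm_sq_zeroWeightVec_of_norm_eq_one hq fun a _ => by split_ifs <;> simp⟩

theorem isTLVector_zero (hq : 0 < q) (h : J = 0 ∨ (n = 1 ∧ J = 1) ∨ (q = 1 ∧ n = 3 ∧ J = 2)) :
    IsTLVector n q J 0 :=
  (isTLVector_iff hq).mpr ⟨rfl, (exists_isTLSeq hq h).imp fun _ => And.left⟩

theorem isTLSolution_iff_eq_qNum (hq : 0 < q)
    (h : J = 0 ∨ (n = 1 ∧ J = 1) ∨ (q = 1 ∧ n = 3 ∧ J = 2)) {v : Space2 n}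
    (hv : IsKet n q J 0 v) {Q : ℝ} (hQ : 0 < Q) :
    IsTLSolution Q ((Q : ℂ) • proj v) ↔ Q = qNum q (2 * spin n + 1) := by
  obtain ⟨z, hz, hnorm⟩ := exists_isTLSeq hq h
  rw [hz.isTLSolution_iff hq hv hQ, hnorm, two_mul_spin]

end Examples

section Classification

variable {n : ℕ} {q : ℝ} {J : ℕ} {z : ℕ → ℂ}

theorem edgeTerm_reverse {a b : ℕ} (hab : a + b = n + 1) :
    edgeTerm n q (fun c => z (n - c)) a = edgeTerm n q z b := by
  rcases a with _ | a
  · rw [edgeTerm_zero, show b = n + 1 by omega, edgeTerm_top]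
  rcases b with _ | b
  · rw [edgeTerm_zero, show a + 1 = n + 1 by omega, edgeTerm_top]
  · rw [edgeTerm, edgeTerm, ladder_symm q hab, show n - (a + 1) = b by omega,
      show n - (a + 1 - 1) = b + 1 by omega, Nat.add_sub_cancel, add_comm (z b)]

theorem IsCasimirSeq.reverse {lam : ℝ} (hz : IsCasimirSeq n 1 lam z) :
    IsCasimirSeq n 1 lam fun a => z (n - a) := by
  intro a ha
  have h := hz (n - a) (Nat.sub_le n a)
  rw [edgeTerm_reverse (show a + 1 + (n - a) = n + 1 by omega),
    edgeTerm_reverse (show a + (n - a + 1) = n + 1 by omega), add_comm, h, Real.one_rpow,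
    Real.one_rpow]

theorem IsTLSeq.norm_eq_one (hz : IsTLSeq n 1 J z) {a : ℕ} (ha : a ≤ n) : ‖z a‖ = 1 := by
  have hprop {a : ℕ} (ha : a ≤ n) : ‖z 0‖ * ‖z (n - a)‖ = ‖z n‖ * ‖z a‖ := by
    simpa only [norm_mul, Nat.sub_zero] using
      congrArg norm (hz.casimir.proportional one_pos hz.casimir.reverse ha)
  have hsq {a : ℕ} (ha : a ≤ n) : ‖z 0‖ = ‖z n‖ * ‖z a‖ ^ 2 := by
    linear_combination ‖z a‖ * hprop ha - ‖z 0‖ * hz.norm_mul_norm a ha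
  have hlast : ‖z n‖ = 1 := by
    have h0 := hz.norm_mul_norm 0 n.zero_le
    rw [Nat.sub_zero, hsq le_rfl] at h0
    exact (pow_eq_one_iff_of_nonneg (norm_nonneg _) four_ne_zero).mp (by linear_combination h0)
  have hfirst : ‖z 0‖ = 1 := by rw [hsq le_rfl, hlast, one_pow, mul_one]
  rw [← pow_eq_one_iff_of_nonneg (norm_nonneg _) two_ne_zero, ← hfirst, hsq ha, hlast, one_mul]

theorem eq_zero_or_eq_two_mul_of_norm_eq {E : Type*} [NormedAddCommGroup E] [NormedSpace ℝ E]
    {w z : E} (hwz : ‖w‖ = ‖z‖) (hz : z ≠ 0) {r c : ℝ} (h : r • (w + z) = c • z) :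
    c = 0 ∨ c = 2 * r := by
  have hnorm : |r| * ‖z‖ = |c - r| * ‖z‖ := by
    rw [← hwz, ← Real.norm_eq_abs, ← norm_smul, hwz, ← Real.norm_eq_abs, ← norm_smul, sub_smul, ← h,
      smul_add, add_sub_cancel_right]
  rcases abs_eq_abs.mp (mul_right_cancel₀ (norm_ne_zero_iff.mpr hz) hnorm) with h | h
  · right; linarith
  · left; linarith

theorem eq_zero_or_eq_two_mul_ladder (hz : ∀ a ≤ n, ‖z a‖ = 1) {a : ℕ} (ha : a ≤ n) {c : ℝ}
    (h : edgeTerm n q z (a + 1) = c * z a) : c = 0 ∨ c = 2 * ladder n q (a + 1) := by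
  have hza : z a ≠ 0 := norm_ne_zero_iff.mp (by rw [hz a ha]; exact one_ne_zero)
  rcases ha.eq_or_lt with rfl | hlt
  · rw [edgeTerm_top, zero_eq_mul, Complex.ofReal_eq_zero] at h
    exact Or.inl (h.resolve_right hza)
  · exact eq_zero_or_eq_two_mul_of_norm_eq ((hz _ hlt).trans (hz a ha).symm) hza
      (by simpa only [edgeTerm, Nat.add_sub_cancel, Complex.real_smul] using h)

theorem IsTLSeq.edgeTerm_add_edgeTerm (hz : IsTLSeq n 1 J z) {a : ℕ} (ha : a ≤ n) :
    edgeTerm n 1 z (a + 1) + edgeTerm n 1 z a = ((J * (J + 1) : ℝ) : ℂ) * z a := by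
  simpa only [qNum_one_left, Real.one_rpow, mul_one] using hz.casimir a ha

theorem IsTLSeq.eq_zero_or_mul_add_one_eq (hz : IsTLSeq n 1 J z) : J = 0 ∨ J * (J + 1) = 2 * n := by
  have h := hz.edgeTerm_add_edgeTerm n.zero_le
  rw [edgeTerm_zero, add_zero] at h
  rcases eq_zero_or_eq_two_mul_ladder (fun _ => hz.norm_eq_one) n.zero_le h with h | h
  · left
    have hJ : J * (J + 1) = 0 := mod_cast h
    exact (mul_eq_zero.mp hJ).resolve_right J.succ_ne_zero
  · right
    rw [ladder_one] at h
    push_cast at h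
    have hJ : (J * (J + 1) : ℝ) = 2 * n := by linear_combination h
    exact_mod_cast hJ

-- The first two relations give `z₁ = z₀` and `z₂ = -z₁`, so the third one reads
-- `4S = 2 [3] [2S - 2] = 6 (2S - 2)`.
theorem IsTLSeq.eq_three (hz : IsTLSeq n 1 J z) (hn : 2 ≤ n) (hJ : J * (J + 1) = 2 * n) :
    n = 3 := by
  have hrec {a : ℕ} (ha : a ≤ n) :
      edgeTerm n 1 z (a + 1) + edgeTerm n 1 z a = ((2 * n : ℝ) : ℂ) * z a := by
    rw [hz.edgeTerm_add_edgeTerm ha]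
    congr 2
    exact_mod_cast hJ
  have hn0 : (n : ℂ) ≠ 0 := by norm_cast; omega
  have h1 : z 1 = z 0 := by
    have h := hrec n.zero_le
    simp only [edgeTerm, ladder_one] at h
    push_cast at h
    refine mul_left_cancel₀ hn0 ?_
    linear_combination h
  have h2 : edgeTerm n 1 z 2 = 0 := by
    have h := hrec (show 1 ≤ n by omega)
    simp only [edgeTerm, ladder_one, Nat.sub_self] at h ⊢
    push_cast at h ⊢
    linear_combination h + n * h1
  have h3 : edgeTerm n 1 z 3 = ((2 * n : ℝ) : ℂ) * z 2 := by
    simpa only [h2, add_zero] using hrec hn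
  rcases eq_zero_or_eq_two_mul_ladder (fun _ => hz.norm_eq_one) hn h3 with h | h
  · norm_num at h
    omega
  · rw [ladder_one] at h
    push_cast at h
    have h3 : (n : ℝ) = 3 := by linear_combination -h / 4
    exact_mod_cast h3

theorem IsTLSeq.classification_one (hz : IsTLSeq n 1 J z) :
    J = 0 ∨ (n = 1 ∧ J = 1) ∨ (n = 3 ∧ J = 2) := by
  rcases hz.eq_zero_or_mul_add_one_eq with hJ | hJ
  · exact Or.inl hJ
  rcases lt_or_ge n 2 with hn | hn
  · have hJ2 : J < 2 := by nlinarith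
    interval_cases n <;> interval_cases J <;> simp_all
  · obtain rfl := hz.eq_three hn hJ
    have hJ2 : J = 2 := by nlinarith
    exact Or.inr (Or.inr ⟨rfl, hJ2⟩)

theorem IsTLSeq.abs_one_sub_sq (hq : 0 < q) (hz : IsTLSeq 3 q 2 z) :
    |1 - (q ^ 2 - (q ^ 2)⁻¹) ^ 2| = 1 := by
  have hq' : (q : ℂ) ≠ 0 := Complex.ofReal_ne_zero.mpr hq.ne'
  have h3 : (qNum q 3 : ℂ) ≠ 0 := Complex.ofReal_ne_zero.mpr (qNum_pos hq three_pos).ne'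
  have hpow3 : q ^ (-3 : ℝ) = (q ^ 3)⁻¹ := by
    rw [Real.rpow_neg hq.le]; norm_cast
  have hz1 : z 1 = (q ^ 4 + q ^ 2 - 1) * z 0 := by
    have h := hz.casimir 0 (by norm_num)
    norm_num [edgeTerm, ladder, qNum_zero, qNum_one hq, qNum_two hq, h3] at h
    field_simp at h
    linear_combination h
  have hz2 : z 2 = (((q : ℂ) ^ 4)⁻¹ + ((q : ℂ) ^ 2)⁻¹ - 1) * z 3 := by
    have h := hz.casimir 3 le_rfl
    norm_num [edgeTerm, ladder, qNum_zero, qNum_one hq, qNum_two hq, hpow3] at h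
    field_simp at h ⊢
    linear_combination h
  have h03 : ‖z 0‖ * ‖z 3‖ = 1 := hz.norm_mul_norm 0 (by norm_num)
  have h12 : ‖z 1‖ * ‖z 2‖ = 1 := hz.norm_mul_norm 1 (by norm_num)
  rw [hz1, hz2, norm_mul, norm_mul, mul_mul_mul_comm, h03, mul_one, ← norm_mul] at h12
  rw [← Real.norm_eq_abs, ← Complex.norm_real]
  refine Eq.trans (congrArg norm ?_) h12
  push_cast
  field_simp
  ring

theorem not_isTLVector_three_two : ¬ IsTLVector 3 2 2 0 := by
  intro h
  obtain ⟨-, z, hz⟩ := (isTLVector_iff two_pos).mp h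
  have := hz.abs_one_sub_sq two_pos
  norm_num at this

theorem isTLVector_one_iff {m : ℤ} : IsTLVector n 1 J m ↔
    (J = 0 ∧ m = 0) ∨ (n = 1 ∧ J = 1 ∧ m = 0) ∨ (n = 3 ∧ J = 2 ∧ m = 0) := by
  constructor
  · intro h
    obtain ⟨rfl, z, hz⟩ := (isTLVector_iff one_pos).mp h
    simpa using hz.classification_one
  · rintro (⟨rfl, rfl⟩ | ⟨rfl, rfl, rfl⟩ | ⟨rfl, rfl, rfl⟩) <;>
    exact isTLVector_zero one_pos (by simp)

end Classification

end TLVec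

end

open TLVec in
theorem theorem5 :
    -- (a) the list of TL vectors at `q = 1`
    (∀ (twoS J : ℕ) (m : ℤ), J ≤ twoS → |m| ≤ (J : ℤ) →
      (IsTLVector twoS 1 J m ↔
        (J = 0 ∧ m = 0) ∨ (twoS = 1 ∧ J = 1 ∧ m = 0) ∨ (twoS = 3 ∧ J = 2 ∧ m = 0))) ∧
    -- (a) the value of `Q` is `2S + 1`
    (∀ (twoS J : ℕ) (m : ℤ),
      (J = 0 ∧ m = 0) ∨ (twoS = 1 ∧ J = 1 ∧ m = 0) ∨ (twoS = 3 ∧ J = 2 ∧ m = 0) →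
      ∀ v : Space2 twoS, IsKet twoS 1 J m v →
      ∀ Q : ℝ, 0 < Q →
        (IsTLSolution Q ((Q : ℂ) • proj v) ↔ Q = 2 * spin twoS + 1)) ∧
    -- (b) the list of vectors that are TL vectors for all `q > 0`
    (∀ (twoS J : ℕ) (m : ℤ), J ≤ twoS → |m| ≤ (J : ℤ) →
      ((∀ q : ℝ, 0 < q → IsTLVector twoS q J m) ↔
        (J = 0 ∧ m = 0) ∨ (twoS = 1 ∧ J = 1 ∧ m = 0))) ∧
    -- (b) the value of `Q` is `[2S + 1]_q`
    (∀ (twoS J : ℕ) (m : ℤ),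
      (J = 0 ∧ m = 0) ∨ (twoS = 1 ∧ J = 1 ∧ m = 0) →
      ∀ q : ℝ, 0 < q →
      ∀ v : Space2 twoS, IsKet twoS q J m v →
      ∀ Q : ℝ, 0 < Q →
        (IsTLSolution Q ((Q : ℂ) • proj v) ↔ Q = qNum q (2 * spin twoS + 1))) := by
  refine ⟨fun twoS J m _ _ => isTLVector_one_iff, fun twoS J m h v hv Q hQ => ?_,
    fun twoS J m _ _ => ⟨fun h => ?_, ?_⟩, ?_⟩
  · obtain rfl : m = 0 := by tauto
    rw [isTLSolution_iff_eq_qNum one_pos (by tauto) hv hQ, qNum_one_left]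
  · rcases isTLVector_one_iff.mp (h 1 one_pos) with h0 | h1 | ⟨rfl, rfl, rfl⟩
    · exact Or.inl h0
    · exact Or.inr h1
    · exact absurd (h 2 two_pos) not_isTLVector_three_two
  · rintro (⟨rfl, rfl⟩ | ⟨rfl, rfl, rfl⟩) q hq
    · exact isTLVector_zero hq (Or.inl rfl)
    · exact isTLVector_zero hq (Or.inr (Or.inl ⟨rfl, rfl⟩))
  · rintro twoS J m (⟨rfl, rfl⟩ | ⟨rfl, rfl, rfl⟩) q hq v hv Q hQ
    · exact isTLSolution_iff_eq_qNum hq (Or.inl rfl) hv hQ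
    · exact isTLSolution_iff_eq_qNum hq (Or.inr (Or.inl ⟨rfl, rfl⟩)) hv hQ
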